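/- Let $\mathbb{F}_q$ be a finite field, let $C_2\subseteq C_1\subseteq\mathbb{F}_q^n$ be linear codes of codimension $\ell=\dim C_1-\dim C_2$, let $\vec b_1,\dots,\vec b_{k_2}$ be a basis of $C_2$ and $\vec b_1,\dots,\vec b_{k_2+\ell}$ a basis of $C_1$. The linear ramp secret sharing scheme defined from $C_2\subseteq C_1$ encodes a secret $\vec x\in\mathbb{F}_q^\ell$ as $\vec c=\sum_{j\le k_2}a_j\vec b_j+\sum_{j\le\ell}x_j\vec b_{k_2+j}$ with $\vec a\in\mathbb{F}_q^{k_2}$ uniformly random, and gives $c_i$ to participant $i$. For a set $A$ of participants, the secrets in accordance with the shares of $A$ form an affine space $\vec p+V_A$ with $V_A\subseteq\mathbb{F}_q^\ell$ a subspace depending only on $A$; one says that $A$ holds $\ell-\dim V_A$ $q$-bits of information. The set $A$ is non-$u$-qualifying if it holds fewer than $u$ $q$-bits of information, and maximum non-$u$-qualifying if moreover it has the largest size among all non-$u$-qualifying sets. For $m=1,\dots,\ell$, let $t_m$ be the largest number ($\le n$) such that no set of $t_m$ participants holds $m$ or more $q$-bits of information, and $r_m$ the smallest number such that every set of $r_m$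 participants holds at least $m$ $q$-bits of information. Let $S_1,S_2\subseteq\mathbb{F}_q$ with $\#S_1=\#S_2=s$, let $S=S_1\times S_2$ and $\Delta(s,s)=\{X_1^aX_2^b\mid 0\le a,b<s\}$, and for $L\subseteq\Delta(s,s)$ let $C(L)\subseteq\mathbb{F}_q^{S}$ be the span of the vectors $(M(\alpha))_{\alpha\in S}$, $M\in L$; the participants are thus the $n=s^2$ points of $S$. Let $\prec$ be the graded lexicographic ordering with $X_1\prec X_2$, that is, $X_1^{a}X_2^{b}\prec X_1^{c}X_2^{d}$ if $a+b<c+d$, or if $a+b=c+d$ and $b<d$. Let $0\le i_1<i_2\le s-1$ and $$L_1=\{N\in\Delta(s,s)\mid N\preceq X_1^{i_1}X_2^{i_2}\},\qquad L_2=\{N\in\Delta(s,s)\mid N\prec X_1^{i_2}X_2^{i_1}\}.$$ Then $C(L_2)\subseteq C(L_1)$ has codimension $\ell=i_2-i_1+1$, and every secret sharing scheme defined from $C(L_2)\subseteq C(L_1)$ satisfies, for $m=1,\dots,\ell$, $$t_m\ge (i_1+m)(i_2+1)-\frac{m(m-1)}{2}-1,$$ $$r_m=s^2-\Big[(s-i_1)(s-i_2)+\sum_{t=2}^{\ell-m+1}\big((s-i_1)-(t-1)\big)\Big]+1=s^2-(s-i_1)(s-i_2+\ell-m)+\frac{(\ell-m+1)(\ell-m)}{2}+1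 .$$ Moreover, write $S_\nu=\{\beta^{(\nu)}_1,\dots,\beta^{(\nu)}_s\}$ for $\nu=1,2$, in any order, and for $w=1,\dots,\ell$ put $$T_w=\{\beta^{(1)}_{(i_2+2)-w},\dots,\beta^{(1)}_s\}\times\{\beta^{(2)}_{i_1+w},\dots,\beta^{(2)}_s\}.$$ Then for every $\mathcal{J}\subseteq\{1,\dots,\ell\}$ the set $S\setminus\bigcup_{i\in\mathcal{J}}T_i$ is non-$u$-qualifying, where $u=\ell+1-\#\mathcal{J}$. If $\mathcal{J}=\{1,\dots,\#\mathcal{J}\}$ or $\mathcal{J}=\{u,\dots,\ell\}$, then this set is maximum non-$u$-qualifying. -/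

import Mathlib

/-- A linear ramp secret sharing scheme given by the coset construction: `base` is a basis of the
small code, and `base` together with `ext` is a basis of the big code. The share of participant `i`
is the `i`-th coordinate of a codeword; secrets are vectors of length `ℓ` over `F`. -/
structure LinearRampScheme (F P : Type*) [Field F] (k₂ ℓ : ℕ) where
  base : Fin k₂ → P → F
  ext : Fin ℓ → P → F
  linearIndependent : LinearIndependent F (Sum.elim base ext)

namespace LinearRampScheme

variable {F P : Type*} [Field F] {k₂ ℓ : ℕ} (R : LinearRampScheme F P k₂ ℓ)

/-- The big code `C₁`. -/
def code₁ : Submodule F (P → F) := Submodule.span F (Set.range (Sum.elim R.base R.ext))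

/-- The small code `C₂`. -/
def code₂ : Submodule F (P → F) := Submodule.span F (Set.range R.base)

/-- The vector of shares of the secret `x`, computed with the random coefficients `a`. -/
def encode (a : Fin k₂ → F) (x : Fin ℓ → F) : P → F :=
  ∑ j, a j • R.base j + ∑ j, x j • R.ext j

/-- The secrets that are in accordance with the shares `c` at the positions in `A`. -/
def possibleSecrets (A : Finset P) (c : P → F) : Set (Fin ℓ → F) :=
  {x | ∃ a, ∀ i ∈ A, R.encode a x i = c i}

/-- The direction `V` of the solution space `p + V` of all secrets in accordance with the shares
held by `A`; see `possibleSecrets_eq`. -/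
def ambiguity (A : Finset P) : Submodule F (Fin ℓ → F) where
  carrier := R.possibleSecrets A 0
  zero_mem' := ⟨0, fun i _ => by simp [encode]⟩
  add_mem' := by
    rintro x y ⟨a, ha⟩ ⟨b, hb⟩
    refine ⟨a + b, fun i hi => ?_⟩
    have h1 := ha i hi
    have h2 := hb i hi
    simp only [encode, Pi.add_apply, add_smul, Finset.sum_add_distrib, Pi.zero_apply] at *
    linear_combination h1 + h2
  smul_mem' := by
    rintro c x ⟨a, ha⟩
    refine ⟨c • a, fun i hi => ?_⟩
    have h1 := ha i hi
    simp only [encode, Pi.add_apply, Pi.smul_apply, smul_assoc, ← Finset.smul_sum,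
      Pi.zero_apply] at *
    rw [← smul_add, h1, smul_zero]

/-- For every actual secret `x` and all shares of it, the set of secrets in accordance with the
shares held by `A` is the affine space `x + V`. -/
theorem possibleSecrets_eq (A : Finset P) (a : Fin k₂ → F) (x : Fin ℓ → F) :
    R.possibleSecrets A (R.encode a x) = {y | y - x ∈ R.ambiguity A} := by
  ext y
  constructor
  · rintro ⟨b, hb⟩
    refine ⟨b - a, fun i hi => ?_⟩
    have h1 := hb i hi
    simp only [encode, Pi.add_apply, Pi.sub_apply, sub_smul, Finset.sum_sub_distrib,
      Pi.zero_apply] at *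
    linear_combination h1
  · rintro ⟨b, hb⟩
    refine ⟨b + a, fun i hi => ?_⟩
    have h1 := hb i hi
    simp only [encode, Pi.add_apply, Pi.sub_apply, sub_smul, add_smul, Finset.sum_sub_distrib,
      Finset.sum_add_distrib, Pi.zero_apply] at *
    linear_combination h1

/-- The number of `q`-bits of information on the secret held by the set `A` of participants,
`ℓ - dim V` (the subtraction never truncates, as `V ⊆ F ^ ℓ`). -/
noncomputable def information (A : Finset P) : ℕ := ℓ - Module.finrank F (R.ambiguity A)

/-- The set `A` cannot recover `i` `q`-bits of information. -/
def NonQualifying (i : ℕ) (A : Finset P) : Prop := R.information A < i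

/-- `A` is of largest possible size among the non-`i`-qualifying sets. -/
def MaximumNonQualifying (i : ℕ) (A : Finset P) : Prop :=
  R.NonQualifying i A ∧ ∀ B : Finset P, R.NonQualifying i B → B.card ≤ A.card

/-- `t` is the privacy number `t_m`: the largest size such that no set of `t` participants can
recover `m` `q`-bits of information. -/
def IsPrivacyNumber [Fintype P] (m t : ℕ) : Prop :=
  IsGreatest {t | t ≤ Fintype.card P ∧
    ∀ A : Finset P, A.card = t → ¬ m ≤ R.information A} t

/-- `r` is the reconstruction number `r_m`: the smallest size such that any set of `r` participants
can recover `m` `q`-bits of information. -/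
def IsReconstructionNumber [Fintype P] (m r : ℕ) : Prop :=
  IsLeast {r | r ≤ Fintype.card P ∧
    ∀ A : Finset P, A.card = r → m ≤ R.information A} r

end LinearRampScheme

namespace MonomialCartesian

/-- The exponent of the monomial `X₁ ^ a * X₂ ^ b`; the variables `X₁`, `X₂` are `X 0`, `X 1`. -/
noncomputable def expo (a b : ℕ) : Fin 2 →₀ ℕ := Finsupp.single 0 a + Finsupp.single 1 b

/-- The (strict) graded lexicographic ordering on monomials in two variables with `X₁ ≺ X₂`. -/
def GrLexLT (d e : Fin 2 →₀ ℕ) : Prop :=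
  d 0 + d 1 < e 0 + e 1 ∨ (d 0 + d 1 = e 0 + e 1 ∧ d 1 < e 1)

/-- The reflexive closure of `GrLexLT`. -/
def GrLexLE (d e : Fin 2 →₀ ℕ) : Prop := GrLexLT d e ∨ d = e

/-- `Δ(s, s)`. -/
def Delta (s : ℕ) : Set (Fin 2 →₀ ℕ) := {d | ∀ v, d v < s}

variable {F : Type*} [Field F]

/-- Evaluation of bivariate polynomials at all the points of `S₁ × S₂`. -/
noncomputable def ev (S₁ S₂ : Finset F) : MvPolynomial (Fin 2) F →ₗ[F] (S₁ × S₂ → F) :=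
  LinearMap.pi fun p => (MvPolynomial.aeval ![(p.1 : F), (p.2 : F)]).toLinearMap

/-- The monomial-Cartesian code `C(L)`. -/
noncomputable def code (S₁ S₂ : Finset F) (L : Set (Fin 2 →₀ ℕ)) : Submodule F (S₁ × S₂ → F) :=
  (Submodule.span F ((fun d => MvPolynomial.monomial d (1 : F)) '' L)).map (ev S₁ S₂)

/-- The box
`T_w = {β₁_((i₂+2)-w), …, β₁_s} × {β₂_(i₁+w), …, β₂_s}`. The element with (one-based) index `j` in
the enumeration `β` is `β ⟨j - 1, _⟩`. -/
def box {s : ℕ} {S₁ S₂ : Finset F} (β₁ : Fin s ≃ S₁) (β₂ : Fin s ≃ S₂) (i₁ i₂ w : ℕ) :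
    Finset (S₁ × S₂) :=
  Finset.univ.filter fun p =>
    (i₂ + 2) - w ≤ (β₁.symm p.1 : ℕ) + 1 ∧ i₁ + w ≤ (β₂.symm p.2 : ℕ) + 1

end MonomialCartesian

/-! The proof is a footprint argument. Call a monomial standard on a point set `A` if its values on
`A` are not a combination of those of smaller monomials. The standard monomials form a basis of the
functions on `A`, so there are exactly `#A` of them (`card_standardFinset`). They are closed under
division, and those in an initial segment of the ordering count the dimension of the restricted
code. The information held by `A` is the drop in dimension from `C₁` to `C₂` after restriction to
`A`. It is therefore the number of standard monomials among the `ℓ` monomials of the antidiagonal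
from `X₁^i₂ X₂^i₁` to `X₁^i₁ X₂^i₂`.

Both bounds now count lattice points. If `v` antidiagonal monomials are not standard, neither are
their multiples, which bounds `#A` from above. If `m` of them are standard, so are their divisors,
which bounds `#A` from below. In either case the union of quadrants is a staircase, and it is
smallest when its corners are consecutive and sit at one end of the antidiagonal
(`card_staircase_ge`).

Removing the boxes `T_w` attains the upper bound: products of linear factors vanishing on the
remaining points make one chosen antidiagonal monomial non-standard per box. Hence `r_m` is exact,
while `t_m` is only bounded. -/

section StandardIndices

/-! ### Greedy bases along a well-ordering -/

variable {K V ι κ : Type*} [Field K] [AddCommGroup V] [Module K V] [LinearOrder κ]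

/-- The indices whose vector is not a linear combination of the vectors of smaller key. -/
def standardIndices (K : Type*) {V ι κ : Type*} [Field K] [AddCommGroup V] [Module K V]
    [LinearOrder κ] (k : ι → κ) (φ : ι → V) : Set ι :=
  {i | φ i ∉ Submodule.span K (φ '' {j | k j < k i})}

theorem span_image_standardIndices_inter [WellFoundedLT κ] (k : ι → κ) (φ : ι → V) (I : Set ι)
    (hI : ∀ i ∈ I, ∀ j, k j < k i → j ∈ I) :
    Submodule.span K (φ '' (standardIndices K k φ ∩ I)) = Submodule.span K (φ '' I) := by
  apply le_antisymm (Submodule.span_mono (Set.image_mono Set.inter_subset_right))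
  rw [Submodule.span_le]
  rintro _ ⟨i, hi, rfl⟩
  suffices h : ∀ c : κ, ∀ i ∈ I, k i = c →
      φ i ∈ Submodule.span K (φ '' (standardIndices K k φ ∩ I)) from h _ i hi rfl
  intro c
  induction c using WellFoundedLT.induction with
  | ind c ih =>
    intro i hi hc
    by_cases hs : i ∈ standardIndices K k φ
    · exact Submodule.subset_span ⟨i, ⟨hs, hi⟩, rfl⟩
    · have h1 : φ i ∈ Submodule.span K (φ '' {j | k j < k i}) := not_not.mp hs
      refine Submodule.span_le.mpr ?_ h1
      rintro _ ⟨j, hj, rfl⟩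
      exact ih (k j) (hc ▸ hj) j (hI i hi j hj) rfl

/-- Adding the vectors of a finite subfamily by increasing key, each one lies outside the span of
its predecessors. -/
theorem linearIndepOn_standardIndices (k : ι → κ) (hk : Function.Injective k) (φ : ι → V) :
    LinearIndepOn K φ (standardIndices K k φ) := by
  classical
  refine linearIndepOn_of_finite _ fun t ht hfin => ?_
  lift t to Finset ι using hfin
  induction t using Finset.induction_on_max_value k with
  | empty => simp
  | insert a t ha hmax ih =>
    rw [Finset.coe_insert] at ht ⊢
    refine (ih ((Set.subset_insert _ _).trans ht)).insert ?_
    intro hmem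
    refine ht (Set.mem_insert _ _) (Submodule.span_mono (Set.image_mono ?_) hmem)
    intro x hx
    refine lt_of_le_of_ne (hmax x hx) fun h => ha ?_
    rw [← hk h]; exact hx

theorem finrank_span_image_eq_card [WellFoundedLT κ] (k : ι → κ) (hk : Function.Injective k)
    (φ : ι → V) (I : Set ι) (hI : ∀ i ∈ I, ∀ j, k j < k i → j ∈ I) (T : Finset ι)
    (hT : ∀ i, i ∈ T ↔ i ∈ standardIndices K k φ ∧ i ∈ I) :
    Module.finrank K (Submodule.span K (φ '' I)) = T.card := by
  have hT' : standardIndices K k φ ∩ I = (T : Set ι) := by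
    ext i; simp [hT]
  have hli : LinearIndepOn K φ (T : Set ι) :=
    (linearIndepOn_standardIndices (K := K) k hk φ).mono (hT' ▸ Set.inter_subset_left)
  rw [← span_image_standardIndices_inter k φ I hI, hT', Set.image_eq_range,
    finrank_span_eq_card hli]
  simp

end StandardIndices

/-! ### Information as a difference of dimensions -/

namespace LinearRampScheme

variable {F P : Type*} [Field F] {k₂ ℓ : ℕ} (R : LinearRampScheme F P k₂ ℓ)

/-- Restriction of vectors of shares to the participants in `A`. -/
def restrict (F : Type*) {P : Type*} [Field F] (A : Finset P) : (P → F) →ₗ[F] (A → F) :=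
  LinearMap.funLeft F F Subtype.val

theorem finrank_code₁ : Module.finrank F R.code₁ = k₂ + ℓ := by
  rw [code₁, finrank_span_eq_card R.linearIndependent]; simp

theorem finrank_code₂ : Module.finrank F R.code₂ = k₂ := by
  have h : LinearIndependent F R.base := by
    simpa [Function.comp_def] using R.linearIndependent.comp Sum.inl Sum.inl_injective
  rw [code₂, finrank_span_eq_card h]; simp

theorem information_mono {A B : Finset P} (h : A ⊆ B) : R.information A ≤ R.information B := by
  have : R.ambiguity B ≤ R.ambiguity A := by
    rintro x ⟨a, ha⟩
    exact ⟨a, fun i hi => ha i (h hi)⟩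
  exact Nat.sub_le_sub_left (Submodule.finrank_mono this) _

/-- The information held by `A` is the difference of the dimensions of the codes
punctured outside `A`. -/
theorem finrank_restrict_code₁ (A : Finset P) :
    Module.finrank F (R.code₁.map (restrict F A)) =
      Module.finrank F (R.code₂.map (restrict F A)) + R.information A := by
  set ρ := restrict F A
  set U := R.code₂.map ρ
  set E : (Fin ℓ → F) →ₗ[F] (A → F) := ρ ∘ₗ Fintype.linearCombination F R.ext
  have h1 : R.code₁.map ρ = LinearMap.range E ⊔ U := by
    simp only [U, E, code₁, code₂, Set.Sum.elim_range, Submodule.span_union, Submodule.map_sup,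
      LinearMap.range_comp, Fintype.range_linearCombination]
    exact sup_comm _ _
  -- `V_A` is the kernel of the map from secrets to shares on `A` modulo the restriction of `C₂`;
  -- the image of this map is the quotient of the two restricted codes.
  have h2 : R.ambiguity A = LinearMap.ker (U.mkQ ∘ₗ E) := by
    ext x
    rw [LinearMap.mem_ker, LinearMap.comp_apply, Submodule.mkQ_apply, Submodule.Quotient.mk_eq_zero]
    constructor
    · rintro ⟨a, ha⟩
      refine ⟨-∑ j, a j • R.base j, ?_, ?_⟩
      · refine neg_mem (sum_mem fun j _ => Submodule.smul_mem _ _ (Submodule.subset_span ⟨j, rfl⟩))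
      · ext i
        have := ha i i.2
        simp only [encode, Pi.add_apply, Pi.zero_apply] at this
        simp only [ρ, E, restrict, LinearMap.funLeft_apply, LinearMap.comp_apply,
          Fintype.linearCombination_apply, Pi.neg_apply]
        linear_combination -this
    · rintro ⟨c, hc, hcx⟩
      have hc' : c ∈ Submodule.span F (Set.range R.base) := hc
      rw [← Fintype.range_linearCombination F] at hc'
      obtain ⟨a, rfl⟩ := hc'
      refine ⟨-a, fun i hi => ?_⟩
      have := congrFun hcx ⟨i, hi⟩
      simp only [ρ, E, restrict, LinearMap.funLeft_apply, LinearMap.comp_apply,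
          Fintype.linearCombination_apply] at this
      simp only [encode, Pi.add_apply, Pi.zero_apply, Pi.neg_apply, neg_smul,
        Finset.sum_neg_distrib]
      linear_combination -this
  have h3 := LinearMap.finrank_range_add_finrank_ker (U.mkQ ∘ₗ E)
  rw [← h2, Module.finrank_fin_fun] at h3
  have h4 : LinearMap.range (U.mkQ ∘ₗ E) = (R.code₁.map ρ).map U.mkQ := by
    rw [h1, Submodule.map_sup, LinearMap.range_comp, Submodule.mkQ_map_self, sup_bot_eq]
  have h5 := LinearMap.finrank_range_add_finrank_ker (U.mkQ.domRestrict (R.code₁.map ρ))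
  have hle : U ≤ R.code₁.map ρ := h1 ▸ le_sup_right
  have h6 := LinearEquiv.finrank_eq (Submodule.submoduleOfEquivOfLe hle)
  rw [Submodule.submoduleOf] at h6
  rw [LinearMap.range_domRestrict, LinearMap.ker_domRestrict, Submodule.ker_mkQ, h6, ← h4] at h5
  unfold information
  omega

end LinearRampScheme

/-! ### Counting lattice points in staircases -/

/-- The points of the square `[0, s)²` that lie above `(c - b, b)` for some `b ∈ J`. -/
def staircase (s c : ℕ) (J : Finset ℕ) : Finset (ℕ × ℕ) :=
  (Finset.range s ×ˢ Finset.range s).filter fun p => ∃ b ∈ J, c ≤ p.1 + b ∧ b ≤ p.2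

theorem mem_staircase {s c : ℕ} {J : Finset ℕ} {p : ℕ × ℕ} :
    p ∈ staircase s c J ↔ (p.1 < s ∧ p.2 < s) ∧ ∃ b ∈ J, c ≤ p.1 + b ∧ b ≤ p.2 := by
  simp [staircase]

/-- The left side is twice the size of the staircase whose corners are the `J.card` consecutive
values ending at `B`: gaps between corners only enlarge the staircase. Keeping the maximum `B` in
the bound lets the induction go through. -/
theorem card_staircase_ge_of_max {s i₁ i₂ : ℕ} (hi : i₂ < s) (J : Finset ℕ) :
    (∀ b ∈ J, i₁ ≤ b ∧ b ≤ i₂) → ∀ B ∈ J, (∀ b ∈ J, b ≤ B) →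
      ((2 * s - i₁ - i₂) ^ 2 - (s - B) ^ 2 - ((s - i₁ - i₂ + B - J.card + 1) ^ 2 + J.card - 1) : ℤ)
        ≤ 2 * (staircase s (i₁ + i₂) J).card := by
  induction J using Finset.induction_on_max with
  | empty => simp
  | insert C J hC ih =>
    intro hJ B hB hmax
    obtain rfl : B = C := by
      rcases Finset.mem_insert.mp hB with h | h
      · exact h
      · have := hC B h
        have := hmax C (Finset.mem_insert_self _ _)
        omega
    have hBJ : B ∉ J := fun h => lt_irrefl _ (hC B h)
    have hB' := hJ B hB
    rw [Finset.card_insert_of_notMem hBJ]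
    rcases J.eq_empty_or_nonempty with rfl | hne
    · have hsub : Finset.Ico (i₁ + i₂ - B) s ×ˢ Finset.Ico B s ⊆
          staircase s (i₁ + i₂) (insert B ∅) := by
        rintro ⟨x, y⟩ h
        simp only [Finset.mem_product, Finset.mem_Ico] at h
        refine mem_staircase.mpr ⟨⟨h.1.2, h.2.2⟩, B, hB, ?_, h.2.1⟩
        simp only; omega
      have hcard := Finset.card_le_card hsub
      rw [Finset.card_product, Nat.card_Ico, Nat.card_Ico] at hcard
      zify [show i₁ + i₂ - B ≤ s by omega, show B ≤ s by omega,
        show B ≤ i₁ + i₂ by omega] at hcard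
      simp only [Finset.card_empty, Nat.cast_one, zero_add]
      nlinarith [hcard]
    · have hJ' : ∀ b ∈ J, i₁ ≤ b ∧ b ≤ i₂ := fun b hb => hJ b (Finset.mem_insert_of_mem hb)
      set B' := J.max' hne with hB'def
      have hB'J : B' ∈ J := J.max'_mem hne
      have hmax' : ∀ b ∈ J, b ≤ B' := fun b hb => J.le_max' b hb
      have h1 := ih hJ' B' hB'J hmax'
      have hlt := hC B' hB'J
      have hb' := hJ' B' hB'J
      have hJcard : J.card ≤ B' + 1 - i₁ := by
        rw [← Nat.card_Icc]
        exact Finset.card_le_card fun b hb => Finset.mem_Icc.mpr ⟨(hJ' b hb).1, hmax' b hb⟩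
      have hdisj : Disjoint (staircase s (i₁ + i₂) J)
          (Finset.Ico (i₁ + i₂ - B) (i₁ + i₂ - B') ×ˢ Finset.Ico B s) := by
        rw [Finset.disjoint_left]
        rintro ⟨x, y⟩ h h'
        obtain ⟨-, b, hb, hb1, -⟩ := mem_staircase.mp h
        simp only [Finset.mem_product, Finset.mem_Ico] at h'
        have := hmax' b hb
        simp only at hb1
        omega
      have hsub : staircase s (i₁ + i₂) J ∪
          (Finset.Ico (i₁ + i₂ - B) (i₁ + i₂ - B') ×ˢ Finset.Ico B s) ⊆
          staircase s (i₁ + i₂) (insert B J) := by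
        rintro ⟨x, y⟩ h
        rcases Finset.mem_union.mp h with h | h
        · obtain ⟨h1, b, hb, h2⟩ := mem_staircase.mp h
          exact mem_staircase.mpr ⟨h1, b, Finset.mem_insert_of_mem hb, h2⟩
        · simp only [Finset.mem_product, Finset.mem_Ico] at h
          refine mem_staircase.mpr ⟨⟨?_, h.2.2⟩, B, hB, ?_, h.2.1⟩
          · simp only; omega
          · simp only; omega
      have hcard := Finset.card_le_card hsub
      rw [Finset.card_union_of_disjoint hdisj, Finset.card_product, Nat.card_Ico,
        Nat.card_Ico] at hcard
      obtain ⟨h, rfl⟩ : ∃ h, B = B' + 1 + h := ⟨B - (B' + 1), by omega⟩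
      rw [show i₁ + i₂ - B' - (i₁ + i₂ - (B' + 1 + h)) = h + 1 by omega] at hcard
      zify [show B' + 1 + h ≤ s by omega] at hcard
      -- `e` counts the gaps of `J` in `[i₁, B']`, and `h` the values skipped between `B'` and the
      -- new corner. Twice the new strip exceeds the growth of the bound by exactly `2 * h * (M +
      -- e)`.
      obtain ⟨e, he⟩ : ∃ e : ℕ, (B' + 1 : ℤ) = i₁ + J.card + e :=
        ⟨B' + 1 - i₁ - J.card, by omega⟩
      obtain ⟨M, hM⟩ : ∃ M : ℕ, (s : ℤ) = i₂ + M + 1 := ⟨s - i₂ - 1, by omega⟩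
      have h3 : (0 : ℤ) ≤ h * (M + e) := by positivity
      have h4 : (s - i₁ - i₂ + B' - J.card + 1 : ℤ) = M + 1 + e := by linarith
      have h5 : (s - i₁ - i₂ + (B' + 1 + h) - (J.card + 1) + 1 : ℤ) = M + 1 + e + h := by linarith
      rw [h4] at h1
      push_cast
      rw [h5]
      linarith

/-- A consecutive block with `e` free places below and `e'` above has a doubled count exceeding this
bound by `2 * e * e'`, so the two extreme positions are the smallest. -/
theorem card_staircase_ge {s i₁ i₂ : ℕ} (hi : i₂ < s) (J : Finset ℕ)
    (hJ : ∀ b ∈ J, i₁ ≤ b ∧ b ≤ i₂) (hne : J.Nonempty) :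
    (2 * (s - i₁) * (s - i₂) + 2 * (J.card - 1) * (s - i₁) - J.card * (J.card - 1) : ℤ)
      ≤ 2 * (staircase s (i₁ + i₂) J).card := by
  have h1 := card_staircase_ge_of_max hi J hJ _ (J.max'_mem hne) fun b hb => J.le_max' b hb
  have hb := hJ _ (J.max'_mem hne)
  have hJcard : J.card ≤ J.max' hne + 1 - i₁ := by
    rw [← Nat.card_Icc]
    exact Finset.card_le_card fun b hb => Finset.mem_Icc.mpr ⟨(hJ b hb).1, J.le_max' b hb⟩
  generalize J.max' hne = B at *
  obtain ⟨e, he⟩ : ∃ e : ℕ, (B + 1 : ℤ) = i₁ + J.card + e := ⟨B + 1 - i₁ - J.card, by omega⟩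
  obtain ⟨e', he'⟩ : ∃ e' : ℕ, (i₂ : ℤ) = B + e' := ⟨i₂ - B, by omega⟩
  have h3 : (0 : ℤ) ≤ e * e' := by positivity
  nlinarith

theorem card_staircase_insert_le {s c : ℕ} (J : Finset ℕ) (b : ℕ) (X : Finset (ℕ × ℕ))
    (h : ∀ x y, x < s → y < s → c ≤ x + b → b ≤ y →
      (x, y) ∈ X ∨ ∃ b' ∈ J, c ≤ x + b' ∧ b' ≤ y) :
    (staircase s c (insert b J)).card ≤ (staircase s c J).card + X.card := by
  refine (Finset.card_le_card ?_).trans (Finset.card_union_le _ _)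
  rintro ⟨x, y⟩ hp
  obtain ⟨⟨hx, hy⟩, b', hb', h1, h2⟩ := mem_staircase.mp hp
  rw [Finset.mem_union, mem_staircase]
  rcases Finset.mem_insert.mp hb' with rfl | hb'
  · rcases h x y hx hy h1 h2 with h | h
    · exact Or.inr h
    · exact Or.inl ⟨⟨hx, hy⟩, h⟩
  · exact Or.inl ⟨⟨hx, hy⟩, b', hb', h1, h2⟩

theorem card_staircase_singleton_le {s c b : ℕ} :
    (staircase s c {b}).card ≤ (s - (c - b)) * (s - b) := by
  rw [← Nat.card_Ico b s, ← Nat.card_Ico (c - b) s, ← Finset.card_product]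
  refine Finset.card_le_card ?_
  rintro ⟨x, y⟩ hp
  obtain ⟨⟨hx, hy⟩, b', hb', h1, h2⟩ := mem_staircase.mp hp
  rw [Finset.mem_singleton] at hb'
  subst hb'
  simp only [Finset.mem_product, Finset.mem_Ico] at *
  omega

/-- Each further corner adds a single column, here of height `s - (i₁ + k + 1)`; for the block at
the other end it adds a row of the same length. So both extreme blocks meet the lower bound. -/
theorem card_staircase_initial_le {s i₁ i₂ : ℕ} (hi : i₂ < s) (k : ℕ) (hk : i₁ + k ≤ i₂) :
    (2 * (staircase s (i₁ + i₂) (Finset.Icc i₁ (i₁ + k))).card : ℤ) ≤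
      2 * (s - i₁) * (s - i₂) + 2 * k * (s - i₁) - (k + 1) * k := by
  induction k with
  | zero =>
    have := card_staircase_singleton_le (s := s) (c := i₁ + i₂) (b := i₁)
    rw [Nat.add_sub_cancel_left] at this
    zify [show i₂ ≤ s by omega, show i₁ ≤ s by omega] at this
    simp only [add_zero, Finset.Icc_self, Nat.cast_zero]
    linarith
  | succ k ih =>
    have h1 := ih (by omega)
    have h2 := card_staircase_insert_le (s := s) (c := i₁ + i₂) (Finset.Icc i₁ (i₁ + k))
      (i₁ + k + 1) ({i₂ - k - 1} ×ˢ Finset.Ico (i₁ + k + 1) s) (by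
        intro x y hx hy hc hb
        by_cases hxk : x = i₂ - k - 1
        · left; simp [hxk]; omega
        · right; exact ⟨i₁ + k, Finset.mem_Icc.mpr (by omega), by omega, by omega⟩)
    rw [show insert (i₁ + k + 1) (Finset.Icc i₁ (i₁ + k)) = Finset.Icc i₁ (i₁ + (k + 1)) by
      ext; simp only [Finset.mem_insert, Finset.mem_Icc]; omega, Finset.card_product,
      Finset.card_singleton, Nat.card_Ico, one_mul] at h2
    zify [show i₁ + k + 1 ≤ s by omega] at h2
    push_cast
    nlinarith

theorem card_staircase_final_le {s i₁ i₂ : ℕ} (hi : i₂ < s) (k : ℕ) (hk : i₁ + k ≤ i₂) :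
    (2 * (staircase s (i₁ + i₂) (Finset.Icc (i₂ - k) i₂)).card : ℤ) ≤
      2 * (s - i₁) * (s - i₂) + 2 * k * (s - i₁) - (k + 1) * k := by
  induction k with
  | zero =>
    have := card_staircase_singleton_le (s := s) (c := i₁ + i₂) (b := i₂)
    rw [Nat.add_sub_cancel] at this
    zify [show i₂ ≤ s by omega, show i₁ ≤ s by omega] at this
    simp only [tsub_zero, Finset.Icc_self, Nat.cast_zero]
    linarith
  | succ k ih =>
    have h1 := ih (by omega)
    have h2 := card_staircase_insert_le (s := s) (c := i₁ + i₂) (Finset.Icc (i₂ - k) i₂)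
      (i₂ - k - 1) (Finset.Ico (i₁ + k + 1) s ×ˢ {i₂ - k - 1}) (by
        intro x y hx hy hc hb
        by_cases hyk : y = i₂ - k - 1
        · left; simp [hyk]; omega
        · right; exact ⟨i₂ - k, Finset.mem_Icc.mpr (by omega), by omega, by omega⟩)
    rw [show insert (i₂ - k - 1) (Finset.Icc (i₂ - k) i₂) = Finset.Icc (i₂ - (k + 1)) i₂ by
      ext; simp only [Finset.mem_insert, Finset.mem_Icc]; omega, Finset.card_product,
      Finset.card_singleton, Nat.card_Ico, mul_one] at h2
    zify [show i₁ + k + 1 ≤ s by omega] at h2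
    push_cast
    nlinarith

/-! ### Standard monomials of a point set -/

namespace MonomialCartesian

open LinearRampScheme (restrict)

/-- The key that sorts the exponent pairs of bivariate monomials by the graded lexicographic
ordering. -/
def grKey (e : ℕ × ℕ) : ℕ ×ₗ ℕ := toLex (e.1 + e.2, e.2)

theorem grKey_lt {d e : ℕ × ℕ} :
    grKey d < grKey e ↔ d.1 + d.2 < e.1 + e.2 ∨ (d.1 + d.2 = e.1 + e.2 ∧ d.2 < e.2) := by
  simp [grKey, Prod.Lex.toLex_lt_toLex]

theorem grKey_injective : Function.Injective grKey := by
  rintro ⟨a, b⟩ ⟨c, d⟩ h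
  simp only [grKey, toLex_inj, Prod.mk.injEq] at h ⊢
  omega

theorem grKey_le {d e : ℕ × ℕ} :
    grKey d ≤ grKey e ↔ d.1 + d.2 < e.1 + e.2 ∨ (d.1 + d.2 = e.1 + e.2 ∧ d.2 ≤ e.2) := by
  simp [grKey, Prod.Lex.toLex_le_toLex]

theorem grKey_add_lt {d e : ℕ × ℕ} (f : ℕ × ℕ) (h : grKey d < grKey e) :
    grKey (d + f) < grKey (e + f) := by
  rw [grKey_lt] at *
  simp only [Prod.fst_add, Prod.snd_add]
  omega

variable {F : Type*} [Field F] {S₁ S₂ : Finset F}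

/-- The values of the monomial with exponent pair `e` at the points of `A`. -/
def monoVec (A : Finset (S₁ × S₂)) (e : ℕ × ℕ) : A → F :=
  fun p => (p.1.1 : F) ^ e.1 * (p.1.2 : F) ^ e.2

/-- The exponent pairs of the monomials that are on `A` not a combination of smaller ones. -/
abbrev standardMonomials (A : Finset (S₁ × S₂)) : Set (ℕ × ℕ) :=
  standardIndices F grKey (monoVec A)

theorem monoVec_add (A : Finset (S₁ × S₂)) (d e : ℕ × ℕ) :
    monoVec A (d + e) = monoVec A e * monoVec A d := by
  ext p
  simp only [monoVec, Prod.fst_add, Prod.snd_add, Pi.mul_apply]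
  ring

/-- Multiplying a relation that expresses a monomial by smaller ones by a fixed monomial gives such
a relation again. The products may leave `Δ(s, s)`, which is why all exponent pairs are indexed. -/
theorem mem_standardMonomials_of_add {A : Finset (S₁ × S₂)} {d : ℕ × ℕ} (e : ℕ × ℕ)
    (h : d + e ∈ standardMonomials A) : d ∈ standardMonomials A := by
  contrapose! h
  have h1 : monoVec A d ∈ Submodule.span F (monoVec A '' {j | grKey j < grKey d}) := not_not.mp h
  refine not_not.mpr ?_
  rw [monoVec_add]
  have h2 := Submodule.mem_map_of_mem (f := LinearMap.mulLeft F (monoVec A e)) h1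
  rw [Submodule.map_span, ← Set.image_comp] at h2
  refine Submodule.span_mono ?_ h2
  rintro _ ⟨j, hj, rfl⟩
  exact ⟨j + e, grKey_add_lt e hj, monoVec_add A j e⟩

theorem mem_standardMonomials_of_le {A : Finset (S₁ × S₂)} {d e : ℕ × ℕ} (hde : d ≤ e)
    (h : e ∈ standardMonomials A) : d ∈ standardMonomials A := by
  refine mem_standardMonomials_of_add (e - d) ?_
  rwa [add_tsub_cancel_of_le hde]

open Polynomial in
theorem eval_mul_eval_eq_sum (A : Finset (S₁ × S₂)) (p q : F[X]) :
    (fun x : A => p.eval (x.1.1 : F) * q.eval (x.1.2 : F)) =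
      ∑ i ∈ Finset.range (p.natDegree + 1), ∑ j ∈ Finset.range (q.natDegree + 1),
        (p.coeff i * q.coeff j) • monoVec A (i, j) := by
  ext x
  rw [eval_eq_sum_range, eval_eq_sum_range, Finset.sum_mul_sum]
  simp only [Finset.sum_apply, Pi.smul_apply, monoVec, smul_eq_mul]
  refine Finset.sum_congr rfl fun i _ => Finset.sum_congr rfl fun j _ => ?_
  ring

open Polynomial in
-- In a graded ordering the leading monomial of `p(X₁) q(X₂)` is the product of the two leading
-- powers; vanishing on `A` expresses it by smaller monomials.
theorem notMem_standardMonomials {A : Finset (S₁ × S₂)} {p q : F[X]} (hp : p.Monic)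
    (hq : q.Monic) (h : ∀ x ∈ A, p.eval (x.1 : F) * q.eval (x.2 : F) = 0) :
    (p.natDegree, q.natDegree) ∉ standardMonomials A := by
  refine not_not.mpr ?_
  set U := Submodule.span F
    (monoVec A '' {j | grKey j < grKey (p.natDegree, q.natDegree)})
  have h1 := eval_mul_eval_eq_sum A p q
  rw [show (fun x : A => p.eval (x.1.1 : F) * q.eval (x.1.2 : F)) = 0 from
    funext fun x => h x x.2] at h1
  symm at h1
  rw [Finset.sum_range_succ, Finset.sum_range_succ, hp.coeff_natDegree, hq.coeff_natDegree,
    one_mul, one_smul, ← add_assoc] at h1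
  rw [eq_neg_of_add_eq_zero_right h1]
  refine neg_mem (add_mem ?_ ?_)
  · refine sum_mem fun i hi => sum_mem fun j hj => Submodule.smul_mem _ _
      (Submodule.subset_span ⟨_, ?_, rfl⟩)
    rw [Finset.mem_range] at hi hj
    rw [Set.mem_ofPred_eq, grKey_lt]
    simp only
    omega
  · refine sum_mem fun j hj => Submodule.smul_mem _ _ (Submodule.subset_span ⟨_, ?_, rfl⟩)
    rw [Finset.mem_range] at hj
    rw [Set.mem_ofPred_eq, grKey_lt]
    simp only
    omega

open Polynomial in
theorem lt_of_mem_standardMonomials {s : ℕ} (hS₁ : S₁.card = s) (hS₂ : S₂.card = s)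
    {A : Finset (S₁ × S₂)} {e : ℕ × ℕ} (he : e ∈ standardMonomials A) : e.1 < s ∧ e.2 < s := by
  have key : ∀ T : Finset F, (∏ t ∈ T, (X - C t)).Monic ∧
      (∏ t ∈ T, (X - C t)).natDegree = T.card ∧
      ∀ t ∈ T, (∏ t ∈ T, (X - C t)).eval t = 0 := fun T =>
    ⟨monic_prod_X_sub_C _ _, by simp, fun t ht => by
      rw [eval_prod]; exact Finset.prod_eq_zero ht (by simp)⟩
  constructor
  · by_contra! hs
    have := notMem_standardMonomials (A := A) (key S₁).1 monic_one
      fun x _ => by rw [(key S₁).2.2 _ x.1.2, zero_mul]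
    rw [(key S₁).2.1, natDegree_one, hS₁] at this
    exact this (mem_standardMonomials_of_le ⟨hs, Nat.zero_le _⟩ he)
  · by_contra! hs
    have := notMem_standardMonomials (A := A) monic_one (key S₂).1
      fun x _ => by rw [(key S₂).2.2 _ x.2.2, mul_zero]
    rw [(key S₂).2.1, natDegree_one, hS₂] at this
    exact this (mem_standardMonomials_of_le ⟨Nat.zero_le _, hs⟩ he)

theorem ev_monomial (d : Fin 2 →₀ ℕ) (p : S₁ × S₂) :
    ev S₁ S₂ (MvPolynomial.monomial d 1) p = (p.1 : F) ^ d 0 * (p.2 : F) ^ d 1 := by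
  simp [ev, MvPolynomial.aeval_monomial, Finsupp.prod_fintype, Fin.prod_univ_two]

theorem map_restrict_code (A : Finset (S₁ × S₂)) (L : Set (Fin 2 →₀ ℕ)) :
    (code S₁ S₂ L).map (restrict F A) =
      Submodule.span F (monoVec A '' ((fun d => (d 0, d 1)) '' L)) := by
  rw [code, Submodule.map_span, Submodule.map_span, ← Set.image_comp, ← Set.image_comp,
    ← Set.image_comp]
  congr 1
  refine Set.image_congr fun d _ => ?_
  ext p
  simp [restrict, LinearMap.funLeft_apply, ev_monomial, monoVec]

open Classical in
/-- The standard monomials of `A` as a finset. -/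
noncomputable def standardFinset (s : ℕ) (A : Finset (S₁ × S₂)) : Finset (ℕ × ℕ) :=
  (Finset.range s ×ˢ Finset.range s).filter (· ∈ standardMonomials A)

variable {s : ℕ}

theorem mem_standardFinset (hS₁ : S₁.card = s) (hS₂ : S₂.card = s) {A : Finset (S₁ × S₂)}
    {e : ℕ × ℕ} : e ∈ standardFinset s A ↔ e ∈ standardMonomials A := by
  simp only [standardFinset, Finset.mem_filter, Finset.mem_product, Finset.mem_range,
    and_iff_right_iff_imp]
  exact lt_of_mem_standardMonomials hS₁ hS₂

open Classical in
/-- The dimension of the code of an initial segment of monomials, punctured outside `A`. -/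
theorem finrank_map_restrict_code (hS₁ : S₁.card = s) (hS₂ : S₂.card = s)
    (A : Finset (S₁ × S₂)) (I : Set (ℕ × ℕ))
    (hI : ∀ i ∈ I, ∀ j, grKey j < grKey i → j ∈ I) :
    Module.finrank F ((code S₁ S₂ {d ∈ Delta s | (d 0, d 1) ∈ I}).map (restrict F A)) =
      ((standardFinset s A).filter (· ∈ I)).card := by
  have hspan : (code S₁ S₂ {d ∈ Delta s | (d 0, d 1) ∈ I}).map (restrict F A) =
      Submodule.span F (monoVec A '' I) := by
    rw [map_restrict_code]
    apply le_antisymm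
    · refine Submodule.span_mono (Set.image_mono ?_)
      rintro _ ⟨d, hd, rfl⟩
      exact hd.2
    -- The segment `I` need not lie in `Δ(s, s)`, but its standard monomials do, and they already
    -- span.
    · rw [← span_image_standardIndices_inter grKey (monoVec A) I hI]
      refine Submodule.span_mono (Set.image_mono ?_)
      rintro ⟨a, b⟩ ⟨he, heI⟩
      have hlt := lt_of_mem_standardMonomials hS₁ hS₂ he
      refine ⟨expo a b, ⟨?_, ?_⟩, ?_⟩
      · intro v
        fin_cases v <;> simp [expo, hlt.1, hlt.2]
      · simpa [expo] using heI
      · simp [expo]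
  rw [hspan]
  refine finrank_span_image_eq_card grKey grKey_injective _ I hI _ fun i => ?_
  rw [Finset.mem_filter, mem_standardFinset hS₁ hS₂]

theorem finrank_map_restrict_univ (W : Submodule F (S₁ × S₂ → F)) :
    Module.finrank F (W.map (restrict F Finset.univ)) = Module.finrank F W := by
  refine (LinearEquiv.finrank_eq (Submodule.equivMapOfInjective _ ?_ W)).symm
  exact LinearMap.funLeft_injective_of_surjective _ _ _ fun x => ⟨⟨x, Finset.mem_univ _⟩, rfl⟩

open Polynomial in
theorem eval_mul_eval_mem_span (A : Finset (S₁ × S₂)) (p q : F[X]) :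
    (fun x : A => p.eval (x.1.1 : F) * q.eval (x.1.2 : F)) ∈
      Submodule.span F (monoVec A '' Set.univ) := by
  rw [eval_mul_eval_eq_sum]
  exact sum_mem fun i _ => sum_mem fun j _ => Submodule.smul_mem _ _
    (Submodule.subset_span ⟨_, trivial, rfl⟩)

/-- Products of Lagrange basis polynomials restrict to the indicators of the points of `A`, so the
monomials span all functions on `A` and the standard ones form a basis. -/
theorem card_standardFinset (hS₁ : S₁.card = s) (hS₂ : S₂.card = s) (A : Finset (S₁ × S₂)) :
    (standardFinset s A).card = A.card := by
  classical
  have h := finrank_span_image_eq_card (K := F) grKey grKey_injective (monoVec A) Set.univ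
    (fun _ _ _ _ => trivial) (standardFinset s A) fun i => by
      rw [mem_standardFinset hS₁ hS₂]; simp
  have htop : Submodule.span F (monoVec A '' Set.univ) = ⊤ := by
    refine eq_top_iff.mpr fun f _ => ?_
    rw [pi_eq_sum_univ' f]
    refine sum_mem fun α _ => Submodule.smul_mem _ _ ?_
    convert eval_mul_eval_mem_span A (Lagrange.basis S₁ id (α.1.1 : F))
      (Lagrange.basis S₂ id (α.1.2 : F)) using 1
    ext β
    by_cases hβ : α = β
    · subst hβ
      have e1 := Lagrange.eval_basis_self (v := id) (Set.injOn_id (S₁ : Set F)) α.1.1.2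
      have e2 := Lagrange.eval_basis_self (v := id) (Set.injOn_id (S₂ : Set F)) α.1.2.2
      simp only [id] at e1 e2
      simp [e1, e2]
    · rw [Pi.single_eq_of_ne (Ne.symm hβ)]
      by_cases h1 : α.1.1 = β.1.1
      · have h2 : (α.1.2 : F) ≠ β.1.2 := fun h2 =>
          hβ (Subtype.ext (Prod.ext h1 (Subtype.ext h2)))
        have e2 := Lagrange.eval_basis_of_ne (v := id) h2 β.1.2.2
        simp only [id] at e2
        simp [e2]
      · have h2 : (α.1.1 : F) ≠ β.1.1 := fun h2 => h1 (Subtype.ext h2)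
        have e2 := Lagrange.eval_basis_of_ne (v := id) h2 β.1.1.2
        simp only [id] at e2
        simp [e2]
  rw [← h, htop, finrank_top, Module.finrank_fintype_fun_eq_card, Fintype.card_coe]

end MonomialCartesian

/-! ### The antidiagonal and the boxes -/

namespace MonomialCartesian

open LinearRampScheme (restrict)

/-- In zero-based coordinates `T_w` is the quadrant with corner `(i₁ + i₂ - b, b)`, where `b = i₁ +
w - 1`. -/
theorem card_biUnion_box {F : Type*} [DecidableEq F] {S₁ S₂ : Finset F} {s i₁ i₂ : ℕ}
    (β₁ : Fin s ≃ S₁) (β₂ : Fin s ≃ S₂) {J : Finset ℕ} (hJ : J ⊆ Finset.Icc 1 (i₂ - i₁ + 1))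
    (hi : i₁ < i₂) :
    (J.biUnion (box β₁ β₂ i₁ i₂)).card =
      (staircase s (i₁ + i₂) (J.image fun w => i₁ + w - 1)).card := by
  refine Finset.card_bij (fun p _ => ((β₁.symm p.1 : ℕ), (β₂.symm p.2 : ℕ))) ?_ ?_ ?_
  · intro p hp
    obtain ⟨w, hw, h⟩ := Finset.mem_biUnion.mp hp
    have hw' := Finset.mem_Icc.mp (hJ hw)
    simp only [box, Finset.mem_filter, Finset.mem_univ, true_and] at h
    refine mem_staircase.mpr ⟨⟨Fin.isLt _, Fin.isLt _⟩, _, Finset.mem_image_of_mem _ hw, ?_⟩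
    simp only
    omega
  · intro p _ q _ h
    simp only [Prod.mk.injEq, Fin.val_inj, EmbeddingLike.apply_eq_iff_eq] at h
    exact Prod.ext h.1 h.2
  · rintro ⟨x, y⟩ hp
    obtain ⟨⟨hx, hy⟩, b, hb, h⟩ := mem_staircase.mp hp
    obtain ⟨w, hw, rfl⟩ := Finset.mem_image.mp hb
    have hw' := Finset.mem_Icc.mp (hJ hw)
    refine ⟨(β₁ ⟨x, hx⟩, β₂ ⟨y, hy⟩), Finset.mem_biUnion.mpr ⟨w, hw, ?_⟩, by simp⟩
    simp only [box, Finset.mem_filter, Finset.mem_univ, true_and, Equiv.symm_apply_apply]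
    simp only at h
    omega

theorem two_mul_card_sdiff_ge {F : Type*} [DecidableEq F] {S₁ S₂ : Finset F} {s i₁ i₂ : ℕ}
    (β₁ : Fin s ≃ S₁) (β₂ : Fin s ≃ S₂) (hS₁ : S₁.card = s) (hS₂ : S₂.card = s)
    (his : i₂ < s) (hi : i₁ < i₂) {J : Finset ℕ} (hJ : J ⊆ Finset.Icc 1 (i₂ - i₁ + 1)) (hne : 1 ≤ J.card)
    (h : J = Finset.Icc 1 J.card ∨ J = Finset.Icc (i₂ - i₁ + 1 + 1 - J.card) (i₂ - i₁ + 1)) :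
    (2 * s ^ 2 - (2 * (s - i₁) * (s - i₂) + 2 * (J.card - 1) * (s - i₁) -
      J.card * (J.card - 1)) : ℤ) ≤
        2 * (Finset.univ \ J.biUnion (box β₁ β₂ i₁ i₂)).card := by
  have hJc : J.card ≤ i₂ - i₁ + 1 := by simpa using Finset.card_le_card hJ
  obtain ⟨k, hk⟩ : ∃ k, J.card = k + 1 := ⟨J.card - 1, by omega⟩
  have hst : (2 * (staircase s (i₁ + i₂) (J.image fun w => i₁ + w - 1)).card : ℤ) ≤
      2 * (s - i₁) * (s - i₂) + 2 * k * (s - i₁) - (k + 1) * k := by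
    rcases h with h | h
    · convert card_staircase_initial_le his k (show i₁ + k ≤ i₂ by omega) using 5
      rw [h, hk]
      ext b
      simp only [Finset.mem_image, Finset.mem_Icc]
      exact ⟨by rintro ⟨w, hw, rfl⟩; omega, fun hb => ⟨b + 1 - i₁, by omega, by omega⟩⟩
    · convert card_staircase_final_le his k (show i₁ + k ≤ i₂ by omega) using 5
      rw [h, hk]
      ext b
      simp only [Finset.mem_image, Finset.mem_Icc]
      exact ⟨by rintro ⟨w, hw, rfl⟩; omega, fun hb => ⟨b + 1 - i₁, by omega, by omega⟩⟩
  have hu : (Finset.univ : Finset (S₁ × S₂)).card = s ^ 2 := by simp [hS₁, hS₂, sq]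
  have hc := Finset.card_sdiff_add_card_eq_card
    (Finset.subset_univ (J.biUnion (box β₁ β₂ i₁ i₂)))
  rw [hu, card_biUnion_box β₁ β₂ hJ hi] at hc
  zify at hc
  rw [hk]
  push_cast
  linarith

variable {F : Type*} [Field F] {S₁ S₂ : Finset F} {s i₁ i₂ : ℕ}

open Classical in
/-- The exponents of `X₂` in the standard monomials of `A` on the segment of the antidiagonal
from `X₁ ^ i₂ * X₂ ^ i₁` to `X₁ ^ i₁ * X₂ ^ i₂`. -/
noncomputable def standardAntidiagonal (i₁ i₂ : ℕ) (A : Finset (S₁ × S₂)) : Finset ℕ :=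
  (Finset.Icc i₁ i₂).filter fun b => (i₁ + i₂ - b, b) ∈ standardMonomials A

theorem mem_standardAntidiagonal {A : Finset (S₁ × S₂)} {b : ℕ} :
    b ∈ standardAntidiagonal i₁ i₂ A ↔
      (i₁ ≤ b ∧ b ≤ i₂) ∧ (i₁ + i₂ - b, b) ∈ standardMonomials A := by
  simp [standardAntidiagonal]

theorem standardAntidiagonal_subset {A : Finset (S₁ × S₂)} :
    standardAntidiagonal i₁ i₂ A ⊆ Finset.Icc i₁ i₂ := fun _ hb =>
  Finset.mem_Icc.mpr (mem_standardAntidiagonal.mp hb).1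

theorem grLexLT_iff {d : Fin 2 →₀ ℕ} {a b : ℕ} :
    GrLexLT d (expo a b) ↔ grKey (d 0, d 1) < grKey (a, b) := by
  rw [grKey_lt]; simp [GrLexLT, expo]

theorem grLexLE_iff {d : Fin 2 →₀ ℕ} {a b : ℕ} :
    GrLexLE d (expo a b) ↔ grKey (d 0, d 1) ≤ grKey (a, b) := by
  rw [GrLexLE, grLexLT_iff, le_iff_lt_or_eq, grKey_injective.eq_iff, Finsupp.ext_iff]
  simp [expo, Fin.forall_fin_two]

/-- The two initial segments differ exactly by the antidiagonal segment, so only the standard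
monomials on it contribute to the difference. -/
theorem finrank_map_restrict_code_le (hS₁ : S₁.card = s) (hS₂ : S₂.card = s) (hi : i₁ < i₂)
    (A : Finset (S₁ × S₂)) :
    Module.finrank F ((code S₁ S₂ {N ∈ Delta s | GrLexLE N (expo i₁ i₂)}).map (restrict F A)) =
      Module.finrank F ((code S₁ S₂ {N ∈ Delta s | GrLexLT N (expo i₂ i₁)}).map (restrict F A)) +
        (standardAntidiagonal i₁ i₂ A).card := by
  classical
  rw [show {N ∈ Delta s | GrLexLE N (expo i₁ i₂)} =
      {N ∈ Delta s | (N 0, N 1) ∈ {e | grKey e ≤ grKey (i₁, i₂)}} from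
        Set.ext fun _ => and_congr_right fun _ => grLexLE_iff,
    show {N ∈ Delta s | GrLexLT N (expo i₂ i₁)} =
      {N ∈ Delta s | (N 0, N 1) ∈ {e | grKey e < grKey (i₂, i₁)}} from
        Set.ext fun _ => and_congr_right fun _ => grLexLT_iff]
  have h1 := finrank_map_restrict_code hS₁ hS₂ A {e | grKey e ≤ grKey (i₁, i₂)}
    fun i hi j hj => hj.le.trans hi
  have h2 := finrank_map_restrict_code hS₁ hS₂ A {e | grKey e < grKey (i₂, i₁)}
    fun i hi j hj => hj.trans hi
  rw [h1, h2]
  have h3 : (standardAntidiagonal i₁ i₂ A).card =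
      ((standardAntidiagonal i₁ i₂ A).image fun b => (i₁ + i₂ - b, b)).card :=
    (Finset.card_image_of_injective _ fun b c h => (Prod.ext_iff.mp h).2).symm
  rw [h3, ← Finset.card_union_of_disjoint]
  · congr 1
    ext ⟨a, b⟩
    simp only [Finset.mem_filter, Finset.mem_union, Finset.mem_image, mem_standardAntidiagonal,
      mem_standardFinset hS₁ hS₂, Set.mem_ofPred_eq, grKey_le, grKey_lt, Prod.mk.injEq]
    constructor
    · rintro ⟨h, h'⟩
      by_cases hlt : a + b < i₂ + i₁ ∨ a + b = i₂ + i₁ ∧ b < i₁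
      · exact Or.inl ⟨h, hlt⟩
      · refine Or.inr ⟨b, ⟨by omega, ?_⟩, by omega, rfl⟩
        rwa [show i₁ + i₂ - b = a by omega]
    · rintro (⟨h, h'⟩ | ⟨b, ⟨h, h'⟩, rfl, rfl⟩)
      · exact ⟨h, by omega⟩
      · exact ⟨h', by omega⟩
  · rw [Finset.disjoint_left]
    rintro ⟨a, b⟩ h h'
    simp only [Finset.mem_filter, Finset.mem_image, mem_standardAntidiagonal,
      Set.mem_ofPred_eq, grKey_lt, Prod.mk.injEq] at h h'
    obtain ⟨b, hb, rfl, rfl⟩ := h'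
    omega

theorem standardAntidiagonal_univ (hS₁ : S₁.card = s) (hS₂ : S₂.card = s) (his : i₂ < s) :
    standardAntidiagonal i₁ i₂ (Finset.univ : Finset (S₁ × S₂)) = Finset.Icc i₁ i₂ := by
  classical
  have h : standardFinset s (Finset.univ : Finset (S₁ × S₂)) = Finset.range s ×ˢ Finset.range s := by
    refine Finset.eq_of_subset_of_card_le (Finset.filter_subset _ _) ?_
    rw [card_standardFinset hS₁ hS₂]
    simp [hS₁, hS₂]
  ext b
  rw [mem_standardAntidiagonal, ← mem_standardFinset hS₁ hS₂, h]
  simp only [Finset.mem_product, Finset.mem_range, Finset.mem_Icc]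
  omega

/-- A standard monomial in the staircase would be a multiple of a non-standard antidiagonal one; so
standard monomials and staircase are disjoint in the square of side `s`. -/
theorem card_add_card_staircase_le (hS₁ : S₁.card = s) (hS₂ : S₂.card = s)
    (A : Finset (S₁ × S₂)) (J : Finset ℕ) (hJ : J ⊆ Finset.Icc i₁ i₂)
    (hd : Disjoint J (standardAntidiagonal i₁ i₂ A)) :
    A.card + (staircase s (i₁ + i₂) J).card ≤ s ^ 2 := by
  classical
  rw [← card_standardFinset hS₁ hS₂, ← Finset.card_union_of_disjoint]
  · calc _ ≤ (Finset.range s ×ˢ Finset.range s).card :=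
          Finset.card_le_card (Finset.union_subset (Finset.filter_subset _ _)
            (Finset.filter_subset _ _))
      _ = s ^ 2 := by simp [sq]
  · rw [Finset.disjoint_left]
    rintro ⟨x, y⟩ h h'
    rw [mem_standardFinset hS₁ hS₂] at h
    obtain ⟨-, b, hb, h1, h2⟩ := mem_staircase.mp h'
    refine Finset.disjoint_left.mp hd hb (mem_standardAntidiagonal.mpr
      ⟨Finset.mem_Icc.mp (hJ hb), mem_standardMonomials_of_le ⟨?_, h2⟩ h⟩)
    simp only at h1 ⊢
    omega

theorem two_mul_card_le (hS₁ : S₁.card = s) (hS₂ : S₂.card = s) (his : i₂ < s)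
    (A : Finset (S₁ × S₂)) (v : ℕ) (hv : 1 ≤ v)
    (h : (standardAntidiagonal i₁ i₂ A).card + v ≤ i₂ + 1 - i₁) :
    (2 * A.card : ℤ) ≤
      2 * s ^ 2 - (2 * (s - i₁) * (s - i₂) + 2 * (v - 1) * (s - i₁) - v * (v - 1)) := by
  have hsub : standardAntidiagonal i₁ i₂ A ⊆ Finset.Icc i₁ i₂ :=
    standardAntidiagonal_subset
  have hcard : v ≤ (Finset.Icc i₁ i₂ \ standardAntidiagonal i₁ i₂ A).card := by
    rw [Finset.card_sdiff_of_subset hsub, Nat.card_Icc]; omega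
  obtain ⟨J, hJ, rfl⟩ := Finset.exists_subset_card_eq hcard
  have h1 := card_add_card_staircase_le hS₁ hS₂ A J (hJ.trans Finset.sdiff_subset)
    (Finset.disjoint_of_subset_left hJ Finset.sdiff_disjoint)
  have h2 := card_staircase_ge his J
    (fun b hb => Finset.mem_Icc.mp (Finset.sdiff_subset (hJ hb))) (Finset.card_pos.mp hv)
  zify at h1
  linarith

theorem two_mul_card_ge (hS₁ : S₁.card = s) (hS₂ : S₂.card = s) (A : Finset (S₁ × S₂))
    (hi : i₁ < i₂) (m : ℕ) (hm : 1 ≤ m) (h : m ≤ (standardAntidiagonal i₁ i₂ A).card) :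
    (2 * (i₁ + m) * (i₂ + 1) - m * (m - 1) : ℤ) ≤ 2 * A.card := by
  classical
  obtain ⟨J, hJ, rfl⟩ := Finset.exists_subset_card_eq h
  have hJ' := fun (b : ℕ) (hb : b ∈ J) => mem_standardAntidiagonal.mp (hJ hb)
  have hinj : Set.InjOn (fun b => i₂ - b) (J : Set ℕ) := by
    intro b hb c hc hbc
    have := (hJ' b hb).1
    have := (hJ' c hc).1
    simp only at hbc
    omega
  -- The reflection `(x, y) ↦ (i₂ - x, i₂ - y)` turns divisors into multiples: the divisors of the
  -- chosen monomials become a staircase in the square of side `i₂ + 1`, with `0` and `i₂ - i₁` in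
  -- place of `i₁` and `i₂`.
  have h1 := card_staircase_ge (s := i₂ + 1) (i₁ := 0) (i₂ := i₂ - i₁) (by omega)
    (J.image fun b => i₂ - b)
    (fun b hb => by
      obtain ⟨c, hc, rfl⟩ := Finset.mem_image.mp hb
      have := (hJ' c hc).1
      omega) ((Finset.card_pos.mp hm).image _)
  rw [Finset.card_image_of_injOn hinj, zero_add] at h1
  have h2 : (staircase (i₂ + 1) (i₂ - i₁) (J.image fun b => i₂ - b)).card ≤ A.card := by
    rw [← card_standardFinset hS₁ hS₂]
    refine Finset.card_le_card_of_injOn (fun p => (i₂ - p.1, i₂ - p.2)) ?_ ?_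
    · rintro ⟨x, y⟩ hp
      obtain ⟨⟨hx, hy⟩, b, hb, h1, h2⟩ := mem_staircase.mp hp
      obtain ⟨c, hc, rfl⟩ := Finset.mem_image.mp hb
      refine (mem_standardFinset hS₁ hS₂).mpr
        (mem_standardMonomials_of_le (Prod.mk_le_mk.mpr ?_) (hJ' c hc).2)
      have := (hJ' c hc).1
      simp only at *
      omega
    · rintro ⟨x, y⟩ hp ⟨x', y'⟩ hp' he
      have h1 := (mem_staircase.mp hp).1
      have h1' := (mem_staircase.mp hp').1
      simp only [Prod.mk.injEq] at *
      omega
  zify [hi.le] at h1 h2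
  linarith

open Polynomial in
theorem exists_monic_eval_eq_zero {T : Finset F} (β : Fin s ≃ T) {a : ℕ} (ha : a ≤ s) :
    ∃ p : F[X], p.Monic ∧ p.natDegree = a ∧ ∀ t : T, (β.symm t : ℕ) < a → p.eval (t : F) = 0 := by
  refine ⟨∏ j : Fin a, (X - C (β (j.castLE ha) : F)), monic_prod_X_sub_C _ _, by simp,
    fun t ht => ?_⟩
  rw [eval_prod]
  refine Finset.prod_eq_zero (Finset.mem_univ ⟨_, ht⟩) ?_
  simp

section Box

variable [DecidableEq F] (β₁ : Fin s ≃ S₁) (β₂ : Fin s ≃ S₂)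

/-- A point outside `T_w` has a small first or a small second index, so it is a zero of one of two
products of linear factors whose degrees are the exponents of this monomial. -/
theorem notMem_standardAntidiagonal (his : i₂ < s) {J : Finset ℕ}
    (hJ : J ⊆ Finset.Icc 1 (i₂ - i₁ + 1)) {w : ℕ} (hw : w ∈ J) :
    i₁ + w - 1 ∉ standardAntidiagonal i₁ i₂
      (Finset.univ \ J.biUnion (box β₁ β₂ i₁ i₂)) := by
  have hw' := Finset.mem_Icc.mp (hJ hw)
  rw [mem_standardAntidiagonal, not_and]
  intro _
  obtain ⟨p, hp, hpd, hp0⟩ := exists_monic_eval_eq_zero β₁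
    (show i₁ + i₂ - (i₁ + w - 1) ≤ s by omega)
  obtain ⟨q, hq, hqd, hq0⟩ := exists_monic_eval_eq_zero β₂ (show i₁ + w - 1 ≤ s by omega)
  rw [← hpd, ← hqd]
  refine notMem_standardMonomials hp hq fun x hx => ?_
  have hx' : x ∉ box β₁ β₂ i₁ i₂ w := fun h =>
    (Finset.mem_sdiff.mp hx).2 (Finset.mem_biUnion.mpr ⟨w, hw, h⟩)
  simp only [box, Finset.mem_filter, Finset.mem_univ, true_and] at hx'
  by_cases h1 : (β₁.symm x.1 : ℕ) < i₁ + i₂ - (i₁ + w - 1)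
  · rw [hp0 _ h1, zero_mul]
  · rw [hq0 _ (by omega), mul_zero]

theorem card_standardAntidiagonal_add_le (his : i₂ < s) {J : Finset ℕ}
    (hJ : J ⊆ Finset.Icc 1 (i₂ - i₁ + 1)) (hi : i₁ < i₂) :
    (standardAntidiagonal i₁ i₂ (Finset.univ \ J.biUnion (box β₁ β₂ i₁ i₂))).card + J.card ≤
      i₂ - i₁ + 1 := by
  have hinj : Set.InjOn (fun w => i₁ + w - 1) (J : Set ℕ) := by
    intro b hb c hc hbc
    have := Finset.mem_Icc.mp (hJ hb)
    have := Finset.mem_Icc.mp (hJ hc)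
    simp only at hbc
    omega
  rw [← Finset.card_image_of_injOn hinj, ← Finset.card_union_of_disjoint]
  · refine (Finset.card_le_card (t := Finset.Icc i₁ i₂) ?_).trans ?_
    · refine Finset.union_subset standardAntidiagonal_subset fun b hb => ?_
      obtain ⟨w, hw, rfl⟩ := Finset.mem_image.mp hb
      have := Finset.mem_Icc.mp (hJ hw)
      rw [Finset.mem_Icc]
      omega
    · rw [Nat.card_Icc]; omega
  · rw [Finset.disjoint_right]
    intro b hb
    obtain ⟨w, hw, rfl⟩ := Finset.mem_image.mp hb
    exact notMem_standardAntidiagonal β₁ β₂ his hJ hw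

end Box

end MonomialCartesian

/-! ### Privacy and reconstruction numbers -/

namespace LinearRampScheme

variable {F P : Type*} [Field F] {k₂ ℓ : ℕ} (R : LinearRampScheme F P k₂ ℓ)

theorem information_empty : R.information ∅ = 0 := by
  have : R.ambiguity ∅ = ⊤ := eq_top_iff.mpr fun x _ => ⟨0, by simp⟩
  rw [information, this, finrank_top, Module.finrank_fin_fun, Nat.sub_self]

theorem exists_isPrivacyNumber [Fintype P] {m : ℕ} (hm : 1 ≤ m) :
    ∃ t, R.IsPrivacyNumber m t := by
  refine BddAbove.exists_isGreatest_of_nonempty ⟨Fintype.card P, fun _ h => h.1⟩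
    ⟨0, Nat.zero_le _, fun A hA => ?_⟩
  rw [Finset.card_eq_zero.mp hA, R.information_empty]
  omega

/-- The reconstruction number exceeds the size of the maximum non-qualifying sets by one. -/
theorem isReconstructionNumber_succ_card [Fintype P] {m : ℕ} {A₀ : Finset P}
    (hA₀ : R.information A₀ < m) (hmax : ∀ A, R.information A < m → A.card ≤ A₀.card)
    (huniv : m ≤ R.information Finset.univ) : R.IsReconstructionNumber m (A₀.card + 1) := by
  refine ⟨⟨?_, fun A hA => ?_⟩, fun r hr => ?_⟩
  · rw [← Finset.card_univ]
    refine Finset.card_lt_card (Finset.ssubset_univ_iff.mpr ?_)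
    rintro rfl
    omega
  · by_contra! h
    have := hmax A h
    omega
  · by_contra! h
    obtain ⟨A, hA, hAr⟩ := Finset.exists_subset_card_eq (show r ≤ A₀.card by omega)
    have := hr.2 A hAr
    have := R.information_mono hA
    omega

end LinearRampScheme

theorem MonomialCartesian.finrank_code_eq {F : Type*} [Field F] {S₁ S₂ : Finset F}
    {s i₁ i₂ : ℕ} (hS₁ : S₁.card = s) (hS₂ : S₂.card = s) (hi : i₁ < i₂) (his : i₂ < s) :
    Module.finrank F (code S₁ S₂ {N ∈ Delta s | GrLexLE N (expo i₁ i₂)}) =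
      Module.finrank F (code S₁ S₂ {N ∈ Delta s | GrLexLT N (expo i₂ i₁)}) + (i₂ - i₁ + 1) := by
  have h := finrank_map_restrict_code_le hS₁ hS₂ hi (Finset.univ : Finset (S₁ × S₂))
  rw [finrank_map_restrict_univ, finrank_map_restrict_univ,
    standardAntidiagonal_univ hS₁ hS₂ his, Nat.card_Icc] at h
  omega

theorem sum_Icc_two_sub (c : ℚ) (v : ℕ) :
    ∑ t ∈ Finset.Icc 2 (v + 1), (c - ((t : ℚ) - 1)) = v * c - (v + 1) * v / 2 := by
  induction v with
  | zero => simp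
  | succ v ih =>
    rw [Finset.sum_Icc_succ_top (by omega), ih]
    push_cast
    ring

theorem mainTheorem1 {F : Type*} [Field F] [Finite F] [DecidableEq F]
    (S₁ S₂ : Finset F) (s i₁ i₂ : ℕ) (hS₁ : S₁.card = s) (hS₂ : S₂.card = s)
    (hi : i₁ < i₂) (his : i₂ ≤ s - 1)
    (β₁ : Fin s ≃ S₁) (β₂ : Fin s ≃ S₂)
    (L₁ L₂ : Set (Fin 2 →₀ ℕ))
    (hL₁ : L₁ = {N ∈ MonomialCartesian.Delta s |
      MonomialCartesian.GrLexLE N (MonomialCartesian.expo i₁ i₂)})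
    (hL₂ : L₂ = {N ∈ MonomialCartesian.Delta s |
      MonomialCartesian.GrLexLT N (MonomialCartesian.expo i₂ i₁)}) :
    MonomialCartesian.code S₁ S₂ L₂ ≤ MonomialCartesian.code S₁ S₂ L₁ ∧
    Module.finrank F (MonomialCartesian.code S₁ S₂ L₁) =
      Module.finrank F (MonomialCartesian.code S₁ S₂ L₂) + (i₂ - i₁ + 1) ∧
    ∀ (k₂ ℓ : ℕ) (R : LinearRampScheme F (S₁ × S₂) k₂ ℓ),
      R.code₁ = MonomialCartesian.code S₁ S₂ L₁ → R.code₂ = MonomialCartesian.code S₁ S₂ L₂ →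
      ℓ = i₂ - i₁ + 1 ∧
      (∀ m : ℕ, 1 ≤ m → m ≤ ℓ →
        (∃ t : ℕ, R.IsPrivacyNumber m t ∧
          (t : ℚ) ≥ (i₁ + m) * (i₂ + 1) - m * (m - 1) / 2 - 1) ∧
        (∃ r : ℕ, R.IsReconstructionNumber m r ∧
          (r : ℚ) = s ^ 2 - ((s - i₁) * (s - i₂) +
            ∑ t ∈ Finset.Icc 2 (ℓ - m + 1), (((s : ℚ) - i₁) - (t - 1))) + 1 ∧
          (r : ℚ) = s ^ 2 - (s - i₁) * (s - i₂ + ℓ - m) + (ℓ - m + 1) * (ℓ - m) / 2 + 1)) ∧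
      (∀ J : Finset ℕ, J ⊆ Finset.Icc 1 ℓ → ∀ u : ℕ, u = ℓ + 1 - J.card →
        R.NonQualifying u (Finset.univ \ J.biUnion (MonomialCartesian.box β₁ β₂ i₁ i₂)) ∧
        (J = Finset.Icc 1 J.card ∨ J = Finset.Icc u ℓ →
          R.MaximumNonQualifying u
            (Finset.univ \ J.biUnion (MonomialCartesian.box β₁ β₂ i₁ i₂)))) := by
  subst hL₁ hL₂
  have hs : i₂ < s := by omega
  refine ⟨?_, ?_, ?_⟩
  · refine Submodule.map_mono (Submodule.span_mono (Set.image_mono ?_))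
    rintro N ⟨hN, hlt⟩
    refine ⟨hN, ?_⟩
    rw [MonomialCartesian.grLexLT_iff, MonomialCartesian.grKey_lt] at hlt
    rw [MonomialCartesian.grLexLE_iff, MonomialCartesian.grKey_le]
    simp only at hlt ⊢
    omega
  · exact MonomialCartesian.finrank_code_eq hS₁ hS₂ hi hs
  · intro k₂ ℓ R hR₁ hR₂
    have hℓ : ℓ = i₂ - i₁ + 1 := by
      have h := MonomialCartesian.finrank_code_eq hS₁ hS₂ hi hs
      rw [← hR₁, ← hR₂, R.finrank_code₁, R.finrank_code₂] at h
      omega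
    have hinfo : ∀ A, R.information A =
        (MonomialCartesian.standardAntidiagonal i₁ i₂ A).card := by
      intro A
      have h1 := R.finrank_restrict_code₁ A
      rw [hR₁, hR₂, MonomialCartesian.finrank_map_restrict_code_le hS₁ hS₂ hi] at h1
      omega
    have hnonq : ∀ J : Finset ℕ, J ⊆ Finset.Icc 1 ℓ → R.NonQualifying (ℓ + 1 - J.card)
        (Finset.univ \ J.biUnion (MonomialCartesian.box β₁ β₂ i₁ i₂)) := by
      intro J hJ
      subst hℓ
      have := MonomialCartesian.card_standardAntidiagonal_add_le β₁ β₂ hs hJ hi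
      rw [LinearRampScheme.NonQualifying, hinfo]
      omega
    refine ⟨hℓ, fun m hm hmℓ => ⟨?_, ?_⟩, fun J hJ u hu => ⟨hu ▸ hnonq J hJ, fun hJ' => ?_⟩⟩
    · have hge : ∀ A, m ≤ R.information A →
          (2 * (i₁ + m) * (i₂ + 1) - m * (m - 1) : ℤ) ≤ 2 * A.card := fun A hA =>
        MonomialCartesian.two_mul_card_ge hS₁ hS₂ A hi m hm (hinfo A ▸ hA)
      obtain ⟨t, ht⟩ := R.exists_isPrivacyNumber hm
      refine ⟨t, ht, ?_⟩
      by_contra! hlt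
      have hlt' : (2 * (t + 1) : ℤ) < 2 * (i₁ + m) * (i₂ + 1) - m * (m - 1) := by
        have : (2 * (t + 1) : ℚ) < 2 * (i₁ + m) * (i₂ + 1) - m * (m - 1) := by linarith
        exact_mod_cast this
      -- All participants together hold `ℓ ≥ m` `q`-bits, so the lower bound applies to them and
      -- shows that `t + 1` does not exceed their number. Then `t + 1` is admissible too, against
      -- the maximality of `t`.
      have huniv := hge Finset.univ (by
        rw [hinfo, MonomialCartesian.standardAntidiagonal_univ hS₁ hS₂ hs, Nat.card_Icc]
        omega)
      rw [Finset.card_univ] at huniv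
      have : t + 1 ≤ t := ht.2 ⟨by omega, fun A hA hmA => by
        have := hge A hmA
        rw [hA] at this
        push_cast at this
        omega⟩
      omega
    · obtain ⟨v, hv⟩ : ∃ v, ℓ = m + v := ⟨ℓ - m, by omega⟩
      -- Removing `v + 1 = ℓ - m + 1` boxes leaves at most `m - 1` `q`-bits; the initial block makes
      -- the remaining set as large as possible.
      have hJ : Finset.Icc 1 (v + 1) ⊆ Finset.Icc 1 ℓ := Finset.Icc_subset_Icc_right (by omega)
      have hA₀ := hnonq _ hJ
      have hA₀card := MonomialCartesian.two_mul_card_sdiff_ge β₁ β₂ hS₁ hS₂ hs hi (hℓ ▸ hJ)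
        (by simp) (Or.inl (by simp))
      set A₀ := Finset.univ \ (Finset.Icc 1 (v + 1)).biUnion
        (MonomialCartesian.box β₁ β₂ i₁ i₂)
      simp only [Nat.card_Icc, Nat.add_sub_cancel] at hA₀ hA₀card
      rw [show ℓ + 1 - (v + 1) = m by omega] at hA₀
      have hle : ∀ A, R.information A < m → (2 * A.card : ℤ) ≤
          2 * s ^ 2 - (2 * (s - i₁) * (s - i₂) + 2 * v * (s - i₁) - (v + 1) * v) := by
        intro A hA
        rw [hinfo] at hA
        have := MonomialCartesian.two_mul_card_le (i₁ := i₁) hS₁ hS₂ hs A (v + 1)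
          (by omega) (by omega)
        push_cast at this
        linarith
      have hmax : ∀ A, R.information A < m → A.card ≤ A₀.card := by
        intro A hA
        have := hle A hA
        push_cast at hA₀card
        zify
        linarith
      have hval : (A₀.card : ℚ) =
          s ^ 2 - (s - i₁) * (s - i₂ + v) + (v + 1) * v / 2 := by
        have h1 : (2 * A₀.card : ℤ) =
            2 * s ^ 2 - (2 * (s - i₁) * (s - i₂) + 2 * v * (s - i₁) - (v + 1) * v) := by
          have := hle A₀ hA₀
          push_cast at hA₀card
          linarith
        have h2 : (2 * A₀.card : ℚ) =
            2 * s ^ 2 - (2 * (s - i₁) * (s - i₂) + 2 * v * (s - i₁) - (v + 1) * v) := by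
          exact_mod_cast h1
        linarith
      refine ⟨A₀.card + 1, R.isReconstructionNumber_succ_card hA₀ hmax ?_, ?_, ?_⟩
      · rw [hinfo, MonomialCartesian.standardAntidiagonal_univ hS₁ hS₂ hs, Nat.card_Icc]
        omega
      · rw [show ℓ - m + 1 = v + 1 by omega, sum_Icc_two_sub]
        push_cast
        rw [hval]
        ring
      · push_cast
        rw [hval, hv]
        push_cast
        ring
    · refine ⟨hu ▸ hnonq J hJ, fun B hB => ?_⟩
      have hJc : J.card ≤ ℓ := by simpa using Finset.card_le_card hJ
      -- With no box removed the set is all of `S`, trivially of largest size; the counting bounds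
      -- need at least one box.
      rcases J.eq_empty_or_nonempty with rfl | hne
      · simpa using Finset.card_le_univ B
      · have h1 := MonomialCartesian.two_mul_card_sdiff_ge β₁ β₂ hS₁ hS₂ hs hi (hℓ ▸ hJ)
          (Finset.card_pos.mpr hne) (by rw [← hℓ, ← hu]; exact hJ')
        rw [LinearRampScheme.NonQualifying, hinfo] at hB
        have h2 := MonomialCartesian.two_mul_card_le (i₁ := i₁) hS₁ hS₂ hs B J.card
          (Finset.card_pos.mpr hne) (by omega)
        zify
        linarith
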